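/- **Theorem ($SO(N)$ master loop equation).** Let $\Lambda$ be a finite two-dimensional cell complex, with a chosen orientation for every edge and every plaquette; let $E^+$ be the set of edges and $\mathcal P^+$ the set of plaquettes with these orientations, and let the boundary $\partial p$ of $p\in\mathcal P^+$ be given as a closed path of oriented edges. A gauge field is a family $Q=(Q_e)_{e\in E^+}\in SO(N)^{E^+}$; it extends to paths by $Q(e^{-1})=Q_e^{-1}$ and $Q(\psi*\gamma)=Q(\psi)Q(\gamma)$, where $\psi*\gamma$ runs through $\gamma$ first and through $\psi$ afterwards. For a loop $\ell$ (a closed path, written as a word in oriented edges in the order of traversal) put $W_\ell=\operatorname{Tr}Q(\ell)$. For $\beta\in\mathbb R$ let $\mathbb E$ be the expectation with respect to the probability measure $$Z^{-1}\exp\Big(\beta N\sum_{p\in\mathcal P^+}\operatorname{Tr}Q(\partial p)\Big)\prod_{e\in E^+}dQ_e,$$ where $dQ_e$ is the Haar measure on $SO(N)$. Fix an edge $e\in E^+$. For a loop $\ell$ let $C_\ell$ be the set of positions at which $e$ or $e^{-1}$ occurs in $\ell$, and for $x\in C_\ell$ let $\omega_x\in\{1,-1\}$ be such that $e^{\omega_x}$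 is the oriented edge at $x$. Let $\ell\setminus e_x$ be the word obtained from $\ell$ by removing the letter at $x$ and reading the remaining letters cyclically from the one after $x$. For $x\ne y$ in $C_\ell$ let $a_{x,y}$ be the part of the cyclic word $\ell$ strictly after $x$ and strictly before $y$. Inverse paths are denoted by the exponent $-1$. Define * mergers, for $x\in C_\ell$, $y\in C_{\ell'}$: $\ \ell\oplus_{x,y}\ell'=(\ell\setminus e_x)\,e^{\omega_x}\,(\ell'\setminus e_y)^{\omega_x\omega_y}\,e^{\omega_x}$ and $\ell\ominus_{x,y}\ell'=(\ell\setminus e_x)\,(\ell'\setminus e_y)^{-\omega_x\omega_y}$; * splits, for $x\ne y$ in $C_\ell$: $\ \times^1_{x,y}\ell=a_{x,y}e^{\omega_y}$, $\times^2_{x,y}\ell=a_{y,x}e^{\omega_x}$ if $\omega_x\omega_y=1$ (positive split), and $\times^1_{x,y}\ell=a_{x,y}$, $\times^2_{x,y}\ell=a_{y,x}$ if $\omega_x\omega_y=-1$ (negative split); * twists, for $x\ne y$ in $C_\ell$: $\ \propto_{x,y}\ell=a_{y,x}\,a_{x,y}^{-1}$ if $\omega_x\omega_y=1$ (negative twist),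 and $\propto_{x,y}\ell=a_{y,x}\,e^{\omega_x}\,a_{x,y}^{-1}\,e^{\omega_y}$ if $\omega_x\omega_y=-1$ (positive twist). Let $\ell_1,\dots,\ell_n$ ($n\ge1$) be loops, $C_i=C_{\ell_i}$, $m=|C_1|$, and let $\mathcal P^+(e)$ be the set of $p\in\mathcal P^+$ whose boundary contains $e$ or $e^{-1}$. Then $$\begin{aligned} (N-1)\,m\,\mathbb E[W_{\ell_1}\cdots W_{\ell_n}] ={}&\sum_{\substack{x\ne y\in C_1\\ \omega_x\omega_y=1}}\mathbb E[W_{\propto_{x,y}\ell_1}W_{\ell_2}\cdots W_{\ell_n}] -\sum_{\substack{x\ne y\in C_1\\ \omega_x\omega_y=-1}}\mathbb E[W_{\propto_{x,y}\ell_1}W_{\ell_2}\cdots W_{\ell_n}]\\ &+\sum_{\substack{x,y\in C_1\\ \omega_x\omega_y=-1}}\mathbb E[W_{\times^1_{x,y}\ell_1}W_{\times^2_{x,y}\ell_1}W_{\ell_2}\cdots W_{\ell_n}] -\sum_{\substack{x\ne y\in C_1\\ \omega_x\omega_y=1}}\mathbb E[W_{\times^1_{x,y}\ell_1}W_{\times^2_{x,y}\ell_1}W_{\ell_2}\cdots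 W_{\ell_n}]\\ &+\sum_{i=2}^n\sum_{x\in C_1,\,y\in C_i}\mathbb E\Big[W_{\ell_1\ominus_{x,y}\ell_i}\prod_{j\ne1,i}W_{\ell_j}\Big] -\sum_{i=2}^n\sum_{x\in C_1,\,y\in C_i}\mathbb E\Big[W_{\ell_1\oplus_{x,y}\ell_i}\prod_{j\ne1,i}W_{\ell_j}\Big]\\ &+N\beta\sum_{p\in\mathcal P^+(e)}\ \sum_{x\in C_1,\,y\in C_{\partial p}}\mathbb E[W_{\ell_1\ominus_{x,y}\partial p}W_{\ell_2}\cdots W_{\ell_n}] -N\beta\sum_{p\in\mathcal P^+(e)}\ \sum_{x\in C_1,\,y\in C_{\partial p}}\mathbb E[W_{\ell_1\oplus_{x,y}\partial p}W_{\ell_2}\cdots W_{\ell_n}], \end{aligned}$$ where all sums over pairs are over ordered pairs. -/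

import Mathlib

open MeasureTheory

namespace LatticeYM

/-! ### Oriented edges, paths, two-dimensional cell complexes -/

/-- An oriented edge `e^ω`: an edge `e ∈ E⁺` with its chosen orientation (`ω = 1`), or with the
opposite orientation (`ω = -1`). -/
abbrev OEdge (E : Type*) := E × ℤˣ

/-- A word in oriented edges, listed in the order in which they are traversed. -/
abbrev EWord (E : Type*) := List (OEdge E)

section Words

variable {V E : Type*}

/-- The vertex at which an oriented edge starts. -/
def OEdge.init (src tgt : E → V) (d : OEdge E) : V := if d.2 = 1 then src d.1 else tgt d.1

/-- The vertex at which an oriented edge ends. -/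
def OEdge.term (src tgt : E → V) (d : OEdge E) : V := if d.2 = 1 then tgt d.1 else src d.1

/-- `IsPath src tgt a b w`: the oriented edges of `w`, traversed one after the other, form a path
from `a` to `b`. -/
def IsPath (src tgt : E → V) : V → V → EWord E → Prop
  | a, b, [] => a = b
  | a, b, d :: w => OEdge.init src tgt d = a ∧ IsPath src tgt (OEdge.term src tgt d) b w

end Words

/-- A two-dimensional cell complex with vertices `V`, edges `E` and plaquettes `P`, each edge and
each plaquette with a chosen orientation (so `E` is `E⁺` and `P` is `𝒫⁺`): every edge has a source
and a target, and every plaquette is glued in along a closed edge path `∂p`. Nothing prevents an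
edge from being traversed several times by the boundary of one plaquette. -/
structure TwoComplex (V E P : Type*) where
  src : E → V
  tgt : E → V
  bdry : P → EWord E
  bdry_closed : ∀ p, ∃ a, IsPath src tgt a a (bdry p)

/-- A loop is a closed path. -/
def TwoComplex.IsLoop {V E P : Type*} (Λ : TwoComplex V E P) (w : EWord E) : Prop :=
  ∃ a, IsPath Λ.src Λ.tgt a a w

/-! ### Operations on loops -/

section Operations

variable {E : Type*}

/-- The inverse path: opposite orientations in the opposite order. -/
def inv (w : EWord E) : EWord E := (w.map fun d => (d.1, -d.2)).reverse

/-- `w^s` for a sign `s`: `w^1 = w`, and `w^{-1}` is the inverse path. -/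
def signPow (w : EWord E) (s : ℤˣ) : EWord E := if s = 1 then w else inv w

/-- The set `C` of occurrences of `e` and `e⁻¹` in `w`, as positions in `w`. -/
def occ [DecidableEq E] (e : E) (w : EWord E) : Finset (Fin w.length) :=
  Finset.univ.filter fun x => (w.get x).1 = e

/-- The orientation `ω_x` of the edge at position `x` of `w`. -/
def sgn (w : EWord E) (x : Fin w.length) : ℤˣ := (w.get x).2

/-- `w ∖ e_x`: the edge at position `x` is removed, and the remaining edges are read cyclically
from the one after position `x`. -/
def cut (w : EWord E) (x : Fin w.length) : EWord E := w.drop (x + 1) ++ w.take x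

/-- For `x ≠ y`, the part of the cyclic word `w` strictly after position `x` and strictly before
position `y`. -/
def arc (w : EWord E) (x y : Fin w.length) : EWord E :=
  if x < y then (w.take y).drop (x + 1) else w.drop (x + 1) ++ w.take y

/-- Positive merger `w ⊕_{x,y} v = (w ∖ e_x) e^{ω_x} (v ∖ e_y)^{ω_x ω_y} e^{ω_x}`. -/
def posMerger (w v : EWord E) (x : Fin w.length) (y : Fin v.length) : EWord E :=
  cut w x ++ [w.get x] ++ signPow (cut v y) (sgn w x * sgn v y) ++ [w.get x]

/-- Negative merger `w ⊖_{x,y} v = (w ∖ e_x) (v ∖ e_y)^{-ω_x ω_y}`. -/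
def negMerger (w v : EWord E) (x : Fin w.length) (y : Fin v.length) : EWord E :=
  cut w x ++ signPow (cut v y) (-(sgn w x * sgn v y))

/-- First loop of the positive split (`ω_x ω_y = 1`): from after `e_x` up to and including
`e_y`. The second loop is `posSplit w y x`. -/
def posSplit (w : EWord E) (x y : Fin w.length) : EWord E := arc w x y ++ [w.get y]

/-- First loop of the negative split (`ω_x ω_y = -1`): from after `e_x` to before `e_y`. The
second loop is `negSplit w y x`. -/
def negSplit (w : EWord E) (x y : Fin w.length) : EWord E := arc w x y

/-- Positive twist (`ω_x ω_y = -1`): the piece of the negative split that leads to `e_x`, then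
`e_x`, then the inverse of the other piece, then `e_y`. -/
def posTwist (w : EWord E) (x y : Fin w.length) : EWord E :=
  negSplit w y x ++ [w.get x] ++ inv (negSplit w x y) ++ [w.get y]

/-- Negative twist (`ω_x ω_y = 1`): the negative merger, at `x` and `y`, of the piece of the
positive split that contains `e_x` with the inverse of the piece that contains `e_y`. Removing
`e_x` and `e_y` from the two pieces leaves `arc w y x` and `(arc w x y)⁻¹`, in which the two
occurrences had opposite orientations, so the merger is the product of these two. -/
def negTwist (w : EWord E) (x y : Fin w.length) : EWord E :=
  arc w y x ++ inv (arc w x y)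

theorem negTwist_eq_negMerger (w : EWord E) (x y : Fin w.length) (h : sgn w x * sgn w y = 1) :
    negTwist w x y = negMerger (posSplit w y x) (inv (posSplit w x y))
      ⟨(arc w y x).length, by simp [posSplit]⟩ ⟨0, by simp [posSplit, inv]⟩ := by
  have h' : (w[(x : ℕ)]).2 * (w[(y : ℕ)]).2 = 1 := h
  simp [negTwist, negMerger, posSplit, inv, cut, sgn, signPow, h']

end Operations

/-! ### The group `SO(N)` and its Haar probability measure -/

/-- The group `SO(N)` of real orthogonal `N × N` matrices of determinant one. -/
abbrev SO (N : ℕ) : Type := Matrix.specialOrthogonalGroup (Fin N) ℝ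

section Group

variable (N : ℕ)

theorem SO.coe_inv (g : SO N) :
    ((g⁻¹ : SO N) : Matrix (Fin N) (Fin N) ℝ) = (g : Matrix (Fin N) (Fin N) ℝ).transpose :=
  rfl

instance : IsTopologicalGroup (SO N) where
  continuous_mul := by
    refine Continuous.subtype_mk ?_ _
    exact (continuous_subtype_val.comp continuous_fst).mul
      (continuous_subtype_val.comp continuous_snd)
  continuous_inv := by
    refine Continuous.subtype_mk ?_ _
    exact continuous_subtype_val.matrix_transpose

instance : CompactSpace (SO N) := by
  refine isCompact_iff_compactSpace.mp ?_
  have hsub : ((Matrix.specialOrthogonalGroup (Fin N) ℝ : Submonoid _) :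
      Set (Matrix (Fin N) (Fin N) ℝ)) ⊆
      (Set.univ.pi fun _ => Set.univ.pi fun _ => Set.Icc (-1 : ℝ) 1) := by
    intro A hA i _ j _
    have h := (Matrix.mem_orthogonalGroup_iff _ _).mp hA.1
    have h1 : ∑ k, A i k * A i k = 1 := by
      have := congrFun (congrFun h i) i
      simpa [Matrix.mul_apply] using this
    have h2 : A i j * A i j ≤ 1 := by
      rw [← h1]
      exact Finset.single_le_sum (f := fun k => A i k * A i k)
        (fun k _ => mul_self_nonneg _) (Finset.mem_univ j)
    exact ⟨by nlinarith, by nlinarith⟩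
  have hcl : IsClosed ((Matrix.specialOrthogonalGroup (Fin N) ℝ : Submonoid _) :
      Set (Matrix (Fin N) (Fin N) ℝ)) := by
    have : ((Matrix.specialOrthogonalGroup (Fin N) ℝ : Submonoid _) :
        Set (Matrix (Fin N) (Fin N) ℝ)) = {A | A * A.transpose = 1} ∩ {A | A.det = 1} := by
      ext A
      simp only [SetLike.mem_coe, Matrix.mem_specialOrthogonalGroup_iff,
        Matrix.mem_orthogonalGroup_iff, Set.mem_inter_iff, Set.mem_ofPred_eq]
    rw [this]
    refine IsClosed.inter (isClosed_eq ?_ continuous_const) (isClosed_eq ?_ continuous_const)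
    · exact continuous_id.mul continuous_id.matrix_transpose
    · exact continuous_id.matrix_det
  exact IsCompact.of_isClosed_subset
    (isCompact_univ_pi fun _ => isCompact_univ_pi fun _ => isCompact_Icc) hcl hsub

instance : MeasurableSpace (SO N) := borel (SO N)

instance : BorelSpace (SO N) := ⟨rfl⟩

/-- The Haar probability measure on `SO(N)`. -/
noncomputable def haarSO : Measure (SO N) := Measure.haarMeasure ⊤

end Group

/-! ### Gauge fields, Wilson loops, the lattice Yang–Mills measure -/

section YangMills

variable {V E P : Type*} {N : ℕ}

/-- The parallel transport `Q(w)` along a path, for the gauge field with value `Q e` on each edge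
`e` with its chosen orientation: `Q(e⁻¹) = Q(e)⁻¹`, and `Q(ψ ∗ γ) = Q(ψ) Q(γ)` for the path that
runs through `γ` first and `ψ` afterwards. -/
def hol (Q : E → SO N) : EWord E → SO N
  | [] => 1
  | d :: w => hol Q w * Q d.1 ^ (d.2 : ℤ)

/-- The Wilson loop `W_w(Q) = Tr Q(w)`. -/
noncomputable def W (w : EWord E) (Q : E → SO N) : ℝ :=
  Matrix.trace (hol Q w : Matrix (Fin N) (Fin N) ℝ)

variable [Fintype E] [Fintype P]

/-- The `SO(N)` lattice Yang–Mills measure with 't Hooft coupling: the probability measure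
`Z⁻¹ exp(β N ∑_{p ∈ 𝒫⁺} Tr Q(∂p)) ∏_e dg_e` on gauge fields. -/
noncomputable def ymMeasure (Λ : TwoComplex V E P) (N : ℕ) (β : ℝ) : Measure (E → SO N) :=
  (Measure.pi fun _ : E => haarSO N).tilted fun Q => β * N * ∑ p, W (Λ.bdry p) Q

/-- Expectation with respect to the lattice Yang–Mills measure. -/
noncomputable def ymExp (Λ : TwoComplex V E P) (N : ℕ) (β : ℝ) (f : (E → SO N) → ℝ) : ℝ :=
  ∫ Q, f Q ∂(ymMeasure Λ N β)

/-- The set `𝒫⁺(e)` of positively oriented plaquettes whose boundary contains `e` or `e⁻¹`. -/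
def plaqs [DecidableEq E] (Λ : TwoComplex V E P) (e : E) : Finset P :=
  Finset.univ.filter fun p => (occ e (Λ.bdry p)).Nonempty

end YangMills

end LatticeYM

open LatticeYM

/-! The loop equation is integration by parts for the Haar measure. Let $X_{ij}=E_{ij}-E_{ji}$ act
on gauge fields as the derivative along left rotations of $Q_e$, and let $S$ be the exponent of the
density. Left invariance gives $\mathbb E[X_{ij}f+f\,X_{ij}S]=0$ (`integral_flowDeriv_eq_zero`,
`ymExp_flowDeriv`). Take $f=(X_{ij}W_{\ell_1})\prod_{k\ge2}W_{\ell_k}$ and sum over all $i,j$. The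
outcome has three groups of terms: the Laplacian of $W_{\ell_1}$, products of first derivatives of
$W_{\ell_1}$ and $W_{\ell_k}$, and products of first derivatives of $W_{\ell_1}$ and $W_{\partial
p}$.

A derivative inserts $\omega_x X_{ij}$ into the holonomy at each occurrence $x$ of $e^{\pm1}$,
always at the end of the letter where $e$ terminates (`hasMatrixDeriv_seg`). The sums over $i,j$ are
evaluated by
$\sum\operatorname{Tr}(AX_{ij}BX_{ij})=2(\operatorname{Tr}AB^T-\operatorname{Tr}A\operatorname{Tr}B)$
and
$\sum\operatorname{Tr}(AX_{ij})\operatorname{Tr}(BX_{ij})=2(\operatorname{Tr}AB^T-\operatorname{Tr}AB)$.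
The factor 2 appears because each plane is counted as $(i,j)$ and as $(j,i)$.

Two insertions in $\ell_1$ at $x\ne y$ give a twist ($AB^T$) and a split; for $x=y$ one has $B=1$,
which yields $-(N-1)W_{\ell_1}$, the left side of the equation (`sum_derivPair_self`,
`sum_derivPair_of_same_sign`, `sum_derivPair_of_opposite_sign`). Insertions in two different loops
give the mergers (`merger_identity`). -/

namespace LatticeYM

/-! ### Integration by parts on a compact group -/

section IntegrationByParts

variable {G : Type*} [Group G]

/-- `g` is the derivative of `f` along the flow of left multiplications by `c t`. -/
def HasFlowDeriv (c : ℝ → G) (f g : G → ℝ) : Prop :=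
  ∀ Q, HasDerivAt (fun t => f (c t * Q)) (g Q) 0

theorem HasFlowDeriv.const_mul {c : ℝ → G} {f f' : G → ℝ} (a : ℝ) (hf : HasFlowDeriv c f f') :
    HasFlowDeriv c (fun Q => a * f Q) (fun Q => a * f' Q) :=
  fun Q => (hf Q).const_mul a

theorem HasFlowDeriv.sum {ι : Type*} {s : Finset ι} {c : ℝ → G} {f f' : ι → G → ℝ}
    (hf : ∀ i ∈ s, HasFlowDeriv c (f i) (f' i)) :
    HasFlowDeriv c (fun Q => ∑ i ∈ s, f i Q) (fun Q => ∑ i ∈ s, f' i Q) :=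
  fun Q => HasDerivAt.fun_sum fun i hi => hf i hi Q

theorem HasFlowDeriv.mul {c : ℝ → G} (h0 : c 0 = 1) {f g f' g' : G → ℝ}
    (hf : HasFlowDeriv c f f') (hg : HasFlowDeriv c g g') :
    HasFlowDeriv c (fun Q => f Q * g Q) (fun Q => f' Q * g Q + f Q * g' Q) :=
  fun Q => by simpa [h0] using (hf Q).fun_mul (hg Q)

theorem HasFlowDeriv.exp {c : ℝ → G} (h0 : c 0 = 1) {f f' : G → ℝ}
    (hf : HasFlowDeriv c f f') :
    HasFlowDeriv c (fun Q => Real.exp (f Q)) (fun Q => Real.exp (f Q) * f' Q) :=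
  fun Q => by simpa [h0] using (hf Q).exp

theorem HasFlowDeriv.prod {ι : Type*} [DecidableEq ι] {s : Finset ι} {c : ℝ → G} (h0 : c 0 = 1)
    {f f' : ι → G → ℝ} (hf : ∀ i ∈ s, HasFlowDeriv c (f i) (f' i)) :
    HasFlowDeriv c (fun Q => ∏ i ∈ s, f i Q)
      (fun Q => ∑ i ∈ s, f' i Q * ∏ j ∈ s.erase i, f j Q) :=
  fun Q => by
    have := HasDerivAt.fun_finsetProd (u := s) (f := fun i t => f i (c t * Q))
      (f' := fun i => f' i Q) (x := 0) fun i hi => hf i hi Q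
    simpa [h0, mul_comm] using this

/-- By left invariance $\int f(c_tQ)\,d\mu$ does not depend on $t$; differentiating under the
integral at $t=0$ gives the claim. Compactness supplies integrability and the dominating constant.
-/
theorem integral_flowDeriv_eq_zero [TopologicalSpace G] [IsTopologicalGroup G] [CompactSpace G]
    [MeasurableSpace G] [BorelSpace G] (μ : Measure G) [IsFiniteMeasure μ]
    [μ.IsMulLeftInvariant] {c : ℝ → G} (hc : ∀ s t, c (s + t) = c s * c t)
    {f g : G → ℝ} (hf : Continuous f) (hg : Continuous g) (h : HasFlowDeriv c f g) :
    ∫ Q, g Q ∂μ = 0 := by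
  have h0 : c 0 = 1 := by simpa using hc 0 0
  obtain ⟨B, hB⟩ : ∃ B, ∀ Q, ‖g Q‖ ≤ B := by
    obtain ⟨B, hB⟩ := isCompact_univ.exists_bound_of_continuousOn hg.continuousOn
    exact ⟨B, fun Q => hB Q (Set.mem_univ Q)⟩
  have hint : ∀ {k : G → ℝ}, Continuous k → Integrable k μ := fun hk =>
    hk.integrable_of_hasCompactSupport (HasCompactSupport.of_compactSpace _)
  -- Domination needs the derivative at every time. Since `c` is a one-parameter group, time `t` at
  -- `Q` is time `0` at `c t * Q`.
  have hderiv : ∀ Q t, HasDerivAt (fun t => f (c t * Q)) (g (c t * Q)) t := by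
    intro Q t
    have h1 := h (c t * Q)
    have h2 : HasDerivAt (fun s => f (c (s - t) * (c t * Q))) (g (c t * Q)) t := by
      have h3 : HasDerivAt (fun s => f (c s * (c t * Q))) (g (c t * Q)) (t - t) := by
        simpa using h1
      exact h3.comp_sub_const t t
    have h5 : (fun s => f (c (s - t) * (c t * Q))) = fun s => f (c s * Q) := by
      funext s
      rw [← mul_assoc, ← hc, sub_add_cancel]
    rwa [h5] at h2
  have key := hasDerivAt_integral_of_dominated_loc_of_deriv_le (μ := μ)
    (F := fun t Q => f (c t * Q)) (F' := fun t Q => g (c t * Q)) (x₀ := 0) (s := Set.univ)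
    (bound := fun _ => B) Filter.univ_mem
    (Filter.Eventually.of_forall fun t =>
      (hint (hf.comp (continuous_const.mul continuous_id))).aestronglyMeasurable)
    (hint (hf.comp (continuous_const.mul continuous_id)))
    (hint (hg.comp (continuous_const.mul continuous_id))).aestronglyMeasurable
    (Filter.Eventually.of_forall fun Q t _ => hB _) (integrable_const B)
    (Filter.Eventually.of_forall fun Q t _ => hderiv Q t)
  have hconst : (fun t => ∫ Q, f (c t * Q) ∂μ) = fun _ => ∫ Q, f Q ∂μ := by
    funext t
    exact integral_mul_left_eq_self f (c t)
  have h6 := key.2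
  rw [hconst] at h6
  simpa [h0] using h6.unique (hasDerivAt_const _ _)

end IntegrationByParts

/-! ### Rotations and the Casimir contraction -/

section Rotations

variable {N : ℕ}

/-- The standard generator `E_ij - E_ji` of `𝔰𝔬(N)`. -/
def soGen (i j : Fin N) : Matrix (Fin N) (Fin N) ℝ :=
  Matrix.single i j 1 - Matrix.single j i 1

theorem soGen_transpose (i j : Fin N) : (soGen i j).transpose = -soGen i j := by
  simp [soGen]

/-- This relation collapses the exponential series of `t • soGen i j` to the closed form in
`rotMatrix`. It also covers `i = j`, where the generator is zero, so no sum over planes has to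
exclude the diagonal. -/
theorem soGen_cube (i j : Fin N) : soGen i j * soGen i j * soGen i j = -soGen i j := by
  rcases eq_or_ne i j with rfl | h
  · simp [soGen]
  · simp only [soGen, sub_mul, mul_sub, Matrix.single_mul_single_same, ne_eq, h, h.symm,
      not_false_eq_true, Matrix.single_mul_single_of_ne, mul_one, zero_mul]
    abel

theorem trace_mul_single_mul_single (A B : Matrix (Fin N) (Fin N) ℝ) (i j k l : Fin N) :
    (A * Matrix.single i j 1 * (B * Matrix.single k l 1)).trace = A l i * B j k := by
  rw [← mul_assoc, Matrix.trace_mul_single]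
  simp [Matrix.mul_apply, Matrix.single_apply, Finset.sum_ite_eq, ite_and]

/-- Contraction of two insertions in one loop. Equal matrix units in both slots contribute entries
of $AB^T$, opposite ones contribute products of diagonal entries. -/
theorem sum_trace_mul_soGen_mul_soGen (A B : Matrix (Fin N) (Fin N) ℝ) :
    ∑ i, ∑ j, (A * soGen i j * (B * soGen i j)).trace =
      2 * ((A * B.transpose).trace - A.trace * B.trace) := by
  have h : ∀ i j, (A * soGen i j * (B * soGen i j)).trace =
      A j i * B j i - A i i * B j j - A j j * B i i + A i j * B i j := by
    intro i j
    simp only [soGen, mul_sub, sub_mul, Matrix.trace_sub, trace_mul_single_mul_single]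
    ring
  have h1 : (A * B.transpose).trace = ∑ i, ∑ j, A i j * B i j := by
    simp [Matrix.trace, Matrix.mul_apply]
  have h2 : A.trace * B.trace = ∑ i, ∑ j, A i i * B j j := by
    simp [Matrix.trace, Finset.sum_mul_sum]
  have h3 : ∑ i, ∑ j, A j i * B j i = ∑ i, ∑ j, A i j * B i j := Finset.sum_comm
  have h4 : ∑ i, ∑ j, A j j * B i i = ∑ i, ∑ j, A i i * B j j := Finset.sum_comm
  simp only [h, Finset.sum_add_distrib, Finset.sum_sub_distrib, h1, h2, h3, h4]
  ring

theorem trace_mul_soGen (A : Matrix (Fin N) (Fin N) ℝ) (i j : Fin N) :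
    (A * soGen i j).trace = A j i - A i j := by
  simp [soGen, mul_sub, Matrix.trace_mul_single]

/-- Contraction of insertions in two different loops: this is what merges them into one trace. -/
theorem sum_trace_mul_soGen_mul_trace_mul_soGen (A B : Matrix (Fin N) (Fin N) ℝ) :
    ∑ i, ∑ j, (A * soGen i j).trace * (B * soGen i j).trace =
      2 * ((A * B.transpose).trace - (A * B).trace) := by
  have h : ∀ i j, (A * soGen i j).trace * (B * soGen i j).trace =
      A j i * B j i - A i j * B j i - A j i * B i j + A i j * B i j := by
    intro i j
    simp only [trace_mul_soGen]
    ring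
  have h1 : (A * B.transpose).trace = ∑ i, ∑ j, A i j * B i j := by
    simp [Matrix.trace, Matrix.mul_apply]
  have h2 : (A * B).trace = ∑ i, ∑ j, A i j * B j i := by
    simp [Matrix.trace, Matrix.mul_apply]
  have h3 : ∑ i, ∑ j, A j i * B j i = ∑ i, ∑ j, A i j * B i j := Finset.sum_comm
  have h4 : ∑ i, ∑ j, A j i * B i j = ∑ i, ∑ j, A i j * B j i := Finset.sum_comm
  simp only [h, Finset.sum_add_distrib, Finset.sum_sub_distrib, h1, h2, h3, h4]
  ring

/-- The rotation by the angle `t` in the `(i, j)`-plane, as a matrix: `exp (t (E_ij - E_ji))`. -/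
noncomputable def rotMatrix (i j : Fin N) (t : ℝ) : Matrix (Fin N) (Fin N) ℝ :=
  1 + Real.sin t • soGen i j + (1 - Real.cos t) • (soGen i j * soGen i j)

theorem rotMatrix_zero (i j : Fin N) : rotMatrix i j 0 = 1 := by simp [rotMatrix]

theorem rotMatrix_add (i j : Fin N) (s t : ℝ) :
    rotMatrix i j (s + t) = rotMatrix i j s * rotMatrix i j t := by
  have h3 := soGen_cube i j
  have h3' : soGen i j * (soGen i j * soGen i j) = -soGen i j := by rw [← mul_assoc, h3]
  have h4 : soGen i j * soGen i j * (soGen i j * soGen i j) = -(soGen i j * soGen i j) := by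
    rw [← mul_assoc, h3, neg_mul]
  simp only [rotMatrix, add_mul, mul_add, one_mul, mul_one, smul_mul_assoc, mul_smul_comm, h3, h3',
    h4, Real.sin_add, Real.cos_add]
  module

theorem rotMatrix_transpose (i j : Fin N) (t : ℝ) :
    (rotMatrix i j t).transpose = rotMatrix i j (-t) := by
  simp [rotMatrix, soGen_transpose, Matrix.transpose_mul]

theorem rotMatrix_mul_transpose (i j : Fin N) (t : ℝ) :
    rotMatrix i j t * (rotMatrix i j t).transpose = 1 := by
  rw [rotMatrix_transpose, ← rotMatrix_add, add_neg_cancel, rotMatrix_zero]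

/-- Orthogonality only gives determinant $\pm1$; being the square of the rotation by `t / 2`
excludes $-1$. -/
theorem rotMatrix_det (i j : Fin N) (t : ℝ) : (rotMatrix i j t).det = 1 := by
  have h : rotMatrix i j t = rotMatrix i j (t / 2) * rotMatrix i j (t / 2) := by
    rw [← rotMatrix_add, add_halves]
  have h1 := congrArg Matrix.det (rotMatrix_mul_transpose i j (t / 2))
  rw [Matrix.det_mul, Matrix.det_transpose, Matrix.det_one] at h1
  rw [h, Matrix.det_mul, h1]

/-- The rotation by the angle `t` in the `(i, j)`-plane, as an element of `SO(N)`. -/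
noncomputable def rot (i j : Fin N) (t : ℝ) : SO N :=
  ⟨rotMatrix i j t, Matrix.mem_specialOrthogonalGroup_iff.mpr
    ⟨(Matrix.mem_orthogonalGroup_iff _ _).mpr (rotMatrix_mul_transpose i j t),
      rotMatrix_det i j t⟩⟩

theorem rot_add (i j : Fin N) (s t : ℝ) : rot i j (s + t) = rot i j s * rot i j t :=
  Subtype.ext (rotMatrix_add i j s t)

theorem rot_zero (i j : Fin N) : rot i j 0 = 1 := Subtype.ext (rotMatrix_zero i j)

/-- `F'` is the entrywise derivative at `0` of the matrix curve `F`. -/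
def HasMatrixDeriv (F : ℝ → Matrix (Fin N) (Fin N) ℝ) (F' : Matrix (Fin N) (Fin N) ℝ) : Prop :=
  ∀ a b, HasDerivAt (fun t => F t a b) (F' a b) 0

theorem hasMatrixDeriv_const (A : Matrix (Fin N) (Fin N) ℝ) : HasMatrixDeriv (fun _ => A) 0 :=
  fun _ _ => hasDerivAt_const _ _

theorem HasMatrixDeriv.mul {F K : ℝ → Matrix (Fin N) (Fin N) ℝ}
    {F' K' : Matrix (Fin N) (Fin N) ℝ} (hF : HasMatrixDeriv F F') (hK : HasMatrixDeriv K K') :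
    HasMatrixDeriv (fun t => F t * K t) (F' * K 0 + F 0 * K') := by
  intro a b
  simp only [Matrix.mul_apply, Matrix.add_apply, ← Finset.sum_add_distrib]
  exact HasDerivAt.fun_sum fun k _ => (hF a k).fun_mul (hK k b)

theorem HasMatrixDeriv.transpose {F : ℝ → Matrix (Fin N) (Fin N) ℝ}
    {F' : Matrix (Fin N) (Fin N) ℝ} (hF : HasMatrixDeriv F F') :
    HasMatrixDeriv (fun t => (F t).transpose) F'.transpose :=
  fun a b => hF b a

theorem HasMatrixDeriv.trace {F : ℝ → Matrix (Fin N) (Fin N) ℝ}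
    {F' : Matrix (Fin N) (Fin N) ℝ} (hF : HasMatrixDeriv F F') :
    HasDerivAt (fun t => (F t).trace) F'.trace 0 :=
  HasDerivAt.fun_sum fun a _ => hF a a

theorem hasMatrixDeriv_rot (i j : Fin N) :
    HasMatrixDeriv (fun t => (rot i j t : Matrix (Fin N) (Fin N) ℝ)) (soGen i j) := by
  intro a b
  have h1 := (Real.hasDerivAt_sin 0).mul_const (soGen i j a b)
  have h2 := ((Real.hasDerivAt_cos 0).const_sub 1).mul_const ((soGen i j * soGen i j) a b)
  have := (h1.const_add ((1 : Matrix (Fin N) (Fin N) ℝ) a b)).fun_add h2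
  simpa [rot, rotMatrix] using this

end Rotations

/-! ### Holonomies of segments of a word -/

section Segments

variable {E : Type*} {N : ℕ}

theorem hol_append (Q : E → SO N) (u v : EWord E) : hol Q (u ++ v) = hol Q v * hol Q u := by
  induction u with
  | nil => simp [hol]
  | cons d u ih => simp [hol, ih, mul_assoc]

theorem hol_singleton (Q : E → SO N) (d : OEdge E) : hol Q [d] = Q d.1 ^ (d.2 : ℤ) := by
  simp [hol]

theorem hol_inv (Q : E → SO N) (w : EWord E) : hol Q (inv w) = (hol Q w)⁻¹ := by
  induction w with
  | nil => simp [hol, inv]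
  | cons d w ih =>
    have h : inv (d :: w) = inv w ++ [(d.1, -d.2)] := by simp [inv]
    rw [h, hol_append, ih, hol_singleton]
    simp [hol]

/-- The trace of an element of `SO(N)`. -/
noncomputable def tr (g : SO N) : ℝ := Matrix.trace (g : Matrix (Fin N) (Fin N) ℝ)

theorem tr_mul_comm (g h : SO N) : tr (g * h) = tr (h * g) := Matrix.trace_mul_comm _ _

theorem tr_inv (g : SO N) : tr g⁻¹ = tr g := by
  rw [tr, SO.coe_inv, Matrix.trace_transpose, tr]

theorem W_eq_tr (w : EWord E) (Q : E → SO N) : W w Q = tr (hol Q w) := rfl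

/-- The holonomy of the segment of `w` between the cut points `a` and `b`. -/
def seg (Q : E → SO N) (w : EWord E) (a b : ℕ) : SO N := hol Q ((w.take b).drop a)

theorem seg_self (Q : E → SO N) (w : EWord E) (a : ℕ) : seg Q w a a = 1 := by
  simp [seg, hol]

/-- The later segment stands on the left, because holonomies multiply against the order of
traversal. -/
theorem seg_mul_seg (Q : E → SO N) (w : EWord E) {a b c : ℕ} (h1 : a ≤ b) (h2 : b ≤ c)
    (h3 : c ≤ w.length) : seg Q w b c * seg Q w a b = seg Q w a c := by
  have h : (w.take c).drop a = (w.take b).drop a ++ (w.take c).drop b := by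
    conv_lhs => rw [← List.take_append_drop b (w.take c)]
    rw [List.take_take, min_eq_left h2, List.drop_append_of_le_length]
    simp; omega
  rw [seg, seg, seg, h, hol_append]

theorem seg_zero_length (Q : E → SO N) (w : EWord E) : seg Q w 0 w.length = hol Q w := by
  simp [seg]

theorem seg_zero (Q : E → SO N) (w : EWord E) (k : ℕ) : seg Q w 0 k = hol Q (w.take k) := by
  simp [seg]

theorem seg_length (Q : E → SO N) (w : EWord E) (k : ℕ) :
    seg Q w k w.length = hol Q (w.drop k) := by
  simp [seg]

theorem seg_succ_self (Q : E → SO N) (w : EWord E) (x : Fin w.length) :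
    seg Q w x (x + 1) = Q (w.get x).1 ^ (sgn w x : ℤ) := by
  have h : (w.take (x + 1)).drop x = [w.get x] := by
    rw [List.drop_take, List.drop_eq_getElem_cons x.2, Nat.add_sub_cancel_left]
    rfl
  rw [seg, h, hol_singleton, sgn]

/-- The end of the edge at position `x` of `w` at which the chosen orientation terminates, as a
cut point of `w`. A left multiplication of the gauge field on that edge acts there. -/
def cutPoint (w : EWord E) (x : Fin w.length) : ℕ := if sgn w x = 1 then x + 1 else x

theorem cutPoint_le_succ (w : EWord E) (x : Fin w.length) : cutPoint w x ≤ x + 1 := by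
  unfold cutPoint; split <;> omega

theorem le_cutPoint (w : EWord E) (x : Fin w.length) : (x : ℕ) ≤ cutPoint w x := by
  unfold cutPoint; split <;> omega

theorem cutPoint_le_length (w : EWord E) (x : Fin w.length) : cutPoint w x ≤ w.length :=
  (cutPoint_le_succ w x).trans x.2

theorem cutPoint_le_of_lt (w : EWord E) {x y : Fin w.length} (h : x < y) : cutPoint w x ≤ y :=
  (cutPoint_le_succ w x).trans h

end Segments

/-! ### Derivatives of Wilson loops -/

section Derivatives

variable {E : Type*} [DecidableEq E] {N : ℕ}

/-- The rotation by the angle `t` in the `(i, j)`-plane, placed on the edge `e`. -/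
noncomputable def edgeRot (e : E) (i j : Fin N) (t : ℝ) : E → SO N := Pi.mulSingle e (rot i j t)

theorem edgeRot_add (e : E) (i j : Fin N) (s t : ℝ) :
    edgeRot e i j (s + t) = edgeRot e i j s * edgeRot e i j t := by
  rw [edgeRot, rot_add, Pi.mulSingle_mul]; rfl

theorem edgeRot_zero (e : E) (i j : Fin N) : edgeRot e i j 0 = 1 := by
  rw [edgeRot, rot_zero, Pi.mulSingle_one]

theorem hasMatrixDeriv_letter_of_ne (e : E) (i j : Fin N) (Q : E → SO N) {d : OEdge E}
    (h : d.1 ≠ e) :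
    HasMatrixDeriv (fun t => (((edgeRot e i j t * Q) d.1 ^ (d.2 : ℤ) : SO N) :
      Matrix (Fin N) (Fin N) ℝ)) 0 := by
  have : ∀ t, (edgeRot e i j t * Q) d.1 = Q d.1 := fun t => by
    simp [edgeRot, Pi.mulSingle_eq_of_ne h]
  simp only [this]
  exact hasMatrixDeriv_const _

theorem hasMatrixDeriv_letter_pos (i j : Fin N) (Q : E → SO N) {d : OEdge E}
    (h : d.2 = 1) :
    HasMatrixDeriv (fun t => (((edgeRot d.1 i j t * Q) d.1 ^ (d.2 : ℤ) : SO N) :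
      Matrix (Fin N) (Fin N) ℝ)) (soGen i j * ((Q d.1 ^ (d.2 : ℤ) : SO N) : Matrix _ _ ℝ)) := by
  have := (hasMatrixDeriv_rot i j).mul (hasMatrixDeriv_const (Q d.1 : Matrix (Fin N) (Fin N) ℝ))
  simpa [h, edgeRot] using this

/-- The inverse is the transpose, so the generator moves to the right of the letter and changes sign
by antisymmetry. This is the source of the factor $\omega_x$ and of the dependence of `cutPoint` on
the sign. -/
theorem hasMatrixDeriv_letter_neg (i j : Fin N) (Q : E → SO N) {d : OEdge E}
    (h : d.2 = -1) :
    HasMatrixDeriv (fun t => (((edgeRot d.1 i j t * Q) d.1 ^ (d.2 : ℤ) : SO N) :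
      Matrix (Fin N) (Fin N) ℝ)) (-(((Q d.1 ^ (d.2 : ℤ) : SO N) : Matrix _ _ ℝ) * soGen i j)) := by
  have := ((hasMatrixDeriv_rot i j).mul
    (hasMatrixDeriv_const (Q d.1 : Matrix (Fin N) (Fin N) ℝ))).transpose
  simpa [h, edgeRot, SO.coe_inv, soGen_transpose, Matrix.transpose_mul] using this

/-- Leibniz rule along the word, by induction on its right end: the new letter multiplies from the
left, and every earlier cut point is at most `b`, so the old terms just acquire that factor. -/
theorem hasMatrixDeriv_seg (e : E) (i j : Fin N) (Q : E → SO N) (w : EWord E) {a b : ℕ}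
    (hab : a ≤ b) (hb : b ≤ w.length) :
    HasMatrixDeriv (fun t => (seg (edgeRot e i j t * Q) w a b : Matrix (Fin N) (Fin N) ℝ))
      (∑ y ∈ (occ e w).filter (fun y : Fin w.length => a ≤ (y : ℕ) ∧ (y : ℕ) < b), ((sgn w y : ℤ) : ℝ) •
        ((seg Q w (cutPoint w y) b : Matrix (Fin N) (Fin N) ℝ) * soGen i j *
          (seg Q w a (cutPoint w y) : Matrix (Fin N) (Fin N) ℝ))) := by
  induction b, hab using Nat.le_induction with
  | base =>
    have h : (occ e w).filter (fun y : Fin w.length => a ≤ (y : ℕ) ∧ (y : ℕ) < a) = ∅ :=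
      Finset.filter_eq_empty_iff.mpr fun y _ => by omega
    simp only [h, Finset.sum_empty, seg_self]
    exact hasMatrixDeriv_const _
  | succ b hab ih =>
    have ih := ih (by omega)
    let z : Fin w.length := ⟨b, hb⟩
    have hz : (z : ℕ) = b := rfl
    have hsplit : ∀ Q : E → SO N, seg Q w a (b + 1) =
        Q (w.get z).1 ^ (sgn w z : ℤ) * seg Q w a b := fun Q => by
      rw [← seg_succ_self, hz, seg_mul_seg Q w hab (Nat.le_succ b) hb]
    have hsum : ∀ y : Fin w.length, (y : ℕ) < b → seg Q w (cutPoint w y) (b + 1) =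
        Q (w.get z).1 ^ (sgn w z : ℤ) * seg Q w (cutPoint w y) b := fun y hy => by
      rw [← seg_succ_self, hz, seg_mul_seg Q w (cutPoint_le_of_lt w (y := z) hy)
        (Nat.le_succ b) hb]
    have hold : ∑ y ∈ (occ e w).filter (fun y : Fin w.length => a ≤ (y : ℕ) ∧ (y : ℕ) < b), ((sgn w y : ℤ) : ℝ) •
        ((seg Q w (cutPoint w y) (b + 1) : Matrix (Fin N) (Fin N) ℝ) * soGen i j *
          (seg Q w a (cutPoint w y) : Matrix (Fin N) (Fin N) ℝ)) =
        ((Q (w.get z).1 ^ (sgn w z : ℤ) : SO N) : Matrix (Fin N) (Fin N) ℝ) *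
        ∑ y ∈ (occ e w).filter (fun y : Fin w.length => a ≤ (y : ℕ) ∧ (y : ℕ) < b), ((sgn w y : ℤ) : ℝ) •
        ((seg Q w (cutPoint w y) b : Matrix (Fin N) (Fin N) ℝ) * soGen i j *
          (seg Q w a (cutPoint w y) : Matrix (Fin N) (Fin N) ℝ)) := by
      rw [Finset.mul_sum]
      refine Finset.sum_congr rfl fun y hy => ?_
      rw [hsum y (Finset.mem_filter.mp hy).2.2, Matrix.mul_smul]
      simp only [Submonoid.coe_mul, mul_assoc]
    by_cases he : (w.get z).1 = e
    · have hfil : (occ e w).filter (fun y : Fin w.length => a ≤ (y : ℕ) ∧ (y : ℕ) < b + 1) =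
          insert z ((occ e w).filter (fun y : Fin w.length => a ≤ (y : ℕ) ∧ (y : ℕ) < b)) := by
        ext y
        simp only [Finset.mem_filter, Finset.mem_insert, occ, Finset.mem_univ, true_and]
        constructor
        · rintro ⟨h1, h2, h3⟩
          by_cases hy : (y : ℕ) = b
          · exact Or.inl (Fin.ext hy)
          · exact Or.inr ⟨h1, h2, by omega⟩
        · rintro (rfl | ⟨h1, h2, h3⟩)
          · exact ⟨he, hab, Nat.lt_succ_self b⟩
          · exact ⟨h1, h2, by omega⟩
      rw [hfil, Finset.sum_insert (by simp [z]), hold]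
      simp only [hsplit, Submonoid.coe_mul]
      have hl : HasMatrixDeriv (fun t => (((edgeRot e i j t * Q) (w.get z).1 ^
          (sgn w z : ℤ) : SO N) : Matrix (Fin N) (Fin N) ℝ))
          (((sgn w z : ℤ) : ℝ) • ((seg Q w (cutPoint w z) (b + 1) : Matrix (Fin N) (Fin N) ℝ) *
            soGen i j * (seg Q w b (cutPoint w z) : Matrix (Fin N) (Fin N) ℝ))) := by
        -- The new letter splits at its cut point into itself and the identity; the sign decides on
        -- which side of the generator the letter stands.
        subst he
        rcases Int.units_eq_one_or (sgn w z) with hs | hs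
        · have hk : cutPoint w z = b + 1 := by simp [cutPoint, hs, hz]
          have := hasMatrixDeriv_letter_pos i j Q (d := w.get z) hs
          rw [hk, seg_self, ← hz, seg_succ_self]
          have hr : ((sgn w z : ℤ) : ℝ) = 1 := by simp [hs]
          rw [hr, one_smul, Submonoid.coe_one, one_mul]
          exact this
        · have hk : cutPoint w z = b := by simp [cutPoint, hs, hz]
          have := hasMatrixDeriv_letter_neg i j Q (d := w.get z) hs
          rw [hk, seg_self, ← hz, seg_succ_self]
          have hr : ((sgn w z : ℤ) : ℝ) = -1 := by simp [hs]
          rw [hr, neg_one_smul, Submonoid.coe_one, mul_one]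
          exact this
      have hmul := hl.mul ih
      convert hmul using 1
      simp only [edgeRot_zero, one_mul, Matrix.smul_mul, mul_assoc]
      rw [← Submonoid.coe_mul, seg_mul_seg Q w hab (le_cutPoint w z) (cutPoint_le_length w z)]
    · have hfil : (occ e w).filter (fun y : Fin w.length => a ≤ (y : ℕ) ∧ (y : ℕ) < b + 1) =
          (occ e w).filter (fun y : Fin w.length => a ≤ (y : ℕ) ∧ (y : ℕ) < b) := by
        ext y
        simp only [Finset.mem_filter, occ, Finset.mem_univ, true_and]
        refine and_congr_right fun h1 => and_congr_right fun h2 => ⟨fun h3 => ?_, fun h3 => by omega⟩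
        rcases Nat.lt_succ_iff_lt_or_eq.mp h3 with h4 | h4
        · exact h4
        · exact absurd (by rw [← h1]; congr 2; exact Fin.ext h4.symm) he
      rw [hfil, hold]
      simp only [hsplit, Submonoid.coe_mul]
      have hmul := (hasMatrixDeriv_letter_of_ne e i j Q he).mul ih
      simpa [edgeRot_zero, sgn] using hmul

/-- The derivative of the Wilson loop of `w` under the infinitesimal rotation `E_ij - E_ji` on
the edge `e`. -/
noncomputable def derivW (e : E) (i j : Fin N) (w : EWord E) (Q : E → SO N) : ℝ :=
  ∑ x ∈ occ e w, ((sgn w x : ℤ) : ℝ) *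
    (((seg Q w 0 (cutPoint w x) * seg Q w (cutPoint w x) w.length : SO N) :
      Matrix (Fin N) (Fin N) ℝ) * soGen i j).trace

theorem hasFlowDeriv_W (e : E) (i j : Fin N) (w : EWord E) :
    HasFlowDeriv (edgeRot e i j) (W w) (derivW e i j w) := by
  intro Q
  have h := (hasMatrixDeriv_seg e i j Q w (Nat.zero_le w.length) le_rfl).trace
  simp only [seg_zero_length] at h
  refine h.congr_deriv ?_
  rw [Matrix.trace_sum, derivW, Finset.filter_true_of_mem (by intro y _; simp)]
  refine Finset.sum_congr rfl fun x _ => ?_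
  rw [Matrix.trace_smul, smul_eq_mul, Matrix.trace_mul_comm, ← mul_assoc, ← Submonoid.coe_mul]

/-- The second derivative of the Wilson loop of `w`, contribution of the positions `x` and `y`. -/
noncomputable def derivPair (i j : Fin N) (w : EWord E) (x y : Fin w.length) (Q : E → SO N) : ℝ :=
  if cutPoint w x ≤ y then
    (((seg Q w 0 (cutPoint w x) * seg Q w (cutPoint w y) w.length : SO N) :
      Matrix (Fin N) (Fin N) ℝ) * soGen i j *
      ((seg Q w (cutPoint w x) (cutPoint w y) : Matrix (Fin N) (Fin N) ℝ) * soGen i j)).trace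
  else
    (((seg Q w 0 (cutPoint w y) * seg Q w (cutPoint w x) w.length : SO N) :
      Matrix (Fin N) (Fin N) ℝ) * soGen i j *
      ((seg Q w (cutPoint w y) (cutPoint w x) : Matrix (Fin N) (Fin N) ℝ) * soGen i j)).trace

theorem trace_cycle_insertion (A B C X : Matrix (Fin N) (Fin N) ℝ) :
    (A * X * B * C * X).trace = (B * C * X * (A * X)).trace := by
  rw [Matrix.trace_mul_comm (B * C * X)]
  simp only [mul_assoc]

/-- The holonomy opened at the cut point of `x` is a product of two segments, and the second
insertion at `y` falls into one of them. The position `x` itself lies in the first segment if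
$\omega_x=1$ and in the second if $\omega_x=-1$. -/
theorem hasFlowDeriv_derivW (e : E) (i j : Fin N) (w : EWord E) :
    HasFlowDeriv (edgeRot e i j) (derivW e i j w) (fun Q =>
      ∑ x ∈ occ e w, ((sgn w x : ℤ) : ℝ) *
        ∑ y ∈ occ e w, ((sgn w y : ℤ) : ℝ) * derivPair i j w x y Q) := by
  refine HasFlowDeriv.sum fun x _ => HasFlowDeriv.const_mul _ fun Q => ?_
  have h1 := hasMatrixDeriv_seg e i j Q w (Nat.zero_le (cutPoint w x)) (cutPoint_le_length w x)
  have h2 := hasMatrixDeriv_seg e i j Q w (cutPoint_le_length w x) le_rfl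
  have h := ((h1.mul h2).mul (hasMatrixDeriv_const (soGen i j))).trace
  simp only [Submonoid.coe_mul]
  refine h.congr_deriv ?_
  have hA : (occ e w).filter (fun y : Fin w.length => 0 ≤ (y : ℕ) ∧ (y : ℕ) < cutPoint w x) =
      (occ e w).filter (fun y : Fin w.length => ¬ cutPoint w x ≤ (y : ℕ)) :=
    Finset.filter_congr fun y _ => by omega
  have hB : (occ e w).filter (fun y : Fin w.length => cutPoint w x ≤ (y : ℕ) ∧ (y : ℕ) < w.length) =
      (occ e w).filter (fun y : Fin w.length => cutPoint w x ≤ (y : ℕ)) :=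
    Finset.filter_congr fun y _ => by omega
  rw [hA, hB, ← Finset.sum_filter_add_sum_filter_not (occ e w) (fun y : Fin w.length => cutPoint w x ≤ (y : ℕ)),
    edgeRot_zero, one_mul, mul_zero, add_zero, add_mul, Matrix.trace_add, add_comm,
    Finset.sum_mul, Finset.mul_sum, Finset.sum_mul, Finset.sum_mul, Matrix.trace_sum,
    Matrix.trace_sum]
  congr 1
  · refine Finset.sum_congr rfl fun y hy => ?_
    rw [derivPair, if_pos (Finset.mem_filter.mp hy).2, Matrix.mul_smul, Matrix.smul_mul,
      Matrix.trace_smul, smul_eq_mul, Submonoid.coe_mul]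
    simp only [mul_assoc]
  · refine Finset.sum_congr rfl fun y hy => ?_
    rw [derivPair, if_neg (Finset.mem_filter.mp hy).2, Matrix.smul_mul, Matrix.smul_mul,
      Matrix.trace_smul, smul_eq_mul, Submonoid.coe_mul]
    rw [trace_cycle_insertion]

end Derivatives

/-! ### Arcs and mergers in terms of holonomies -/

section Contractions

variable {E : Type*} {N : ℕ}

theorem tr_eq_of_conj {g g' : SO N} (h : SO N) (hg : g' = h * g * h⁻¹) : tr g = tr g' := by
  rw [hg, tr_mul_comm, inv_mul_cancel_left]

theorem trace_mul_transpose_eq_tr (g h : SO N) :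
    ((g : Matrix (Fin N) (Fin N) ℝ) * (h : Matrix (Fin N) (Fin N) ℝ).transpose).trace =
      tr (g * h⁻¹) := rfl

/-- The holonomy around the cyclic word `w` from the cut point at `x` to the cut point at `y`. -/
def arcHol (Q : E → SO N) (w : EWord E) (x y : Fin w.length) : SO N :=
  if x < y then seg Q w (cutPoint w x) (cutPoint w y)
  else seg Q w 0 (cutPoint w y) * seg Q w (cutPoint w x) w.length

/-- The holonomy around the cyclic word `w` that starts and ends at the cut point at `x`. -/
def rotHol (Q : E → SO N) (w : EWord E) (x : Fin w.length) : SO N :=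
  seg Q w 0 (cutPoint w x) * seg Q w (cutPoint w x) w.length

/-- The part in front of the cut point of the holonomy of an edge with sign `s` and gauge field
`g`. -/
def letterBefore (g : SO N) (s : ℤˣ) : SO N := if s = 1 then g else 1

/-- The part behind the cut point of the holonomy of an edge with sign `s` and gauge field `g`. -/
def letterAfter (g : SO N) (s : ℤˣ) : SO N := if s = 1 then 1 else g⁻¹

theorem tr_rotHol (Q : E → SO N) (w : EWord E) (x : Fin w.length) :
    tr (rotHol Q w x) = W w Q := by
  rw [rotHol, tr_mul_comm, seg_mul_seg Q w (Nat.zero_le _) (cutPoint_le_length w x) le_rfl,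
    seg_zero_length, W_eq_tr]

/-- Both insertions sit at the same cut point, so the contraction applies with $B=1$ and gives
$\operatorname{Tr}A-N\operatorname{Tr}A$. -/
theorem sum_derivPair_self (w : EWord E) (x : Fin w.length) (Q : E → SO N) :
    ∑ i, ∑ j, derivPair i j w x x Q = 2 * (-((N : ℝ) - 1) * W w Q) := by
  have h : ∀ i j, derivPair i j w x x Q = ((rotHol Q w x : Matrix (Fin N) (Fin N) ℝ) *
      soGen i j * ((1 : Matrix (Fin N) (Fin N) ℝ) * soGen i j)).trace := fun i j => by
    simp [derivPair, seg_self, rotHol]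
  simp only [h]
  rw [sum_trace_mul_soGen_mul_soGen, Matrix.transpose_one, mul_one, Matrix.trace_one,
    Fintype.card_fin, ← tr_rotHol Q w x, tr]
  ring

/-- Two insertions cut the cyclic word into two arcs. The order of `x` and `y` only exchanges $A$
and $B$, which is harmless because a trace on `SO N` is invariant under inversion. -/
theorem sum_derivPair (w : EWord E) {x y : Fin w.length} (hxy : x ≠ y) (Q : E → SO N) :
    ∑ i, ∑ j, derivPair i j w x y Q =
      2 * (tr (arcHol Q w y x * (arcHol Q w x y)⁻¹) -
        tr (arcHol Q w x y) * tr (arcHol Q w y x)) := by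
  rcases lt_or_gt_of_ne hxy with h | h
  · have hd : ∀ i j, derivPair i j w x y Q = ((arcHol Q w y x : Matrix (Fin N) (Fin N) ℝ) *
        soGen i j * ((arcHol Q w x y : Matrix (Fin N) (Fin N) ℝ) * soGen i j)).trace :=
      fun i j => by
        rw [derivPair, if_pos (cutPoint_le_of_lt w h), arcHol, arcHol, if_neg h.not_gt, if_pos h]
    simp only [hd]
    rw [sum_trace_mul_soGen_mul_soGen, trace_mul_transpose_eq_tr, mul_comm (Matrix.trace _)]
    rfl
  · have hd : ∀ i j, derivPair i j w x y Q = ((arcHol Q w x y : Matrix (Fin N) (Fin N) ℝ) *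
        soGen i j * ((arcHol Q w y x : Matrix (Fin N) (Fin N) ℝ) * soGen i j)).trace :=
      fun i j => by
        have hk : ¬ cutPoint w x ≤ (y : ℕ) := fun hk =>
          absurd ((le_cutPoint w x).trans hk) (not_le.mpr h)
        rw [derivPair, if_neg hk, arcHol, arcHol, if_neg h.not_gt, if_pos h]
    simp only [hd]
    rw [sum_trace_mul_soGen_mul_soGen, trace_mul_transpose_eq_tr, ← tr_inv (_ * _), mul_inv_rev,
      inv_inv]
    rfl

variable [DecidableEq E]

theorem letter_eq (Q : E → SO N) {e : E} {w : EWord E} {x : Fin w.length} (hx : x ∈ occ e w) :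
    Q (w.get x).1 ^ (sgn w x : ℤ) = Q e ^ (sgn w x : ℤ) := by
  rw [(Finset.mem_filter.mp hx).2]

theorem seg_to_cutPoint (Q : E → SO N) {e : E} {w : EWord E} {x : Fin w.length}
    (hx : x ∈ occ e w) : seg Q w x (cutPoint w x) = letterBefore (Q e) (sgn w x) := by
  have h := (seg_succ_self Q w x).trans (letter_eq Q hx)
  rcases Int.units_eq_one_or (sgn w x) with hs | hs
  · simpa [cutPoint, letterBefore, hs] using h
  · simp [cutPoint, letterBefore, hs, seg_self]

theorem seg_from_cutPoint (Q : E → SO N) {e : E} {w : EWord E} {x : Fin w.length}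
    (hx : x ∈ occ e w) : seg Q w (cutPoint w x) (x + 1) = letterAfter (Q e) (sgn w x) := by
  have h := (seg_succ_self Q w x).trans (letter_eq Q hx)
  rcases Int.units_eq_one_or (sgn w x) with hs | hs
  · simp [cutPoint, letterAfter, hs, seg_self]
  · simpa [cutPoint, letterAfter, hs] using h

theorem seg_before (Q : E → SO N) {e : E} {w : EWord E} {x : Fin w.length} (hx : x ∈ occ e w)
    {a : ℕ} (h : a ≤ x) :
    seg Q w a (cutPoint w x) = letterBefore (Q e) (sgn w x) * seg Q w a x := by
  rw [← seg_to_cutPoint Q hx, seg_mul_seg Q w h (le_cutPoint w x) (cutPoint_le_length w x)]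

theorem seg_after (Q : E → SO N) {e : E} {w : EWord E} {x : Fin w.length} (hx : x ∈ occ e w)
    {b : ℕ} (h : x + 1 ≤ b) (hb : b ≤ w.length) :
    seg Q w (cutPoint w x) b = seg Q w (x + 1) b * letterAfter (Q e) (sgn w x) := by
  rw [← seg_from_cutPoint Q hx, seg_mul_seg Q w (cutPoint_le_succ w x) h hb]

/-- Passage from cut points, where derivatives act, to words with the letter removed, in which the
loop operations are written. -/
theorem rotHol_eq (Q : E → SO N) {e : E} {w : EWord E} {x : Fin w.length} (hx : x ∈ occ e w) :
    rotHol Q w x =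
      letterBefore (Q e) (sgn w x) * hol Q (cut w x) * letterAfter (Q e) (sgn w x) := by
  rw [rotHol, seg_before Q hx (Nat.zero_le _), seg_after Q hx x.2 le_rfl, cut, hol_append,
    seg_zero, seg_length]
  simp only [mul_assoc]

theorem arcHol_eq (Q : E → SO N) {e : E} {w : EWord E} {x y : Fin w.length} (hx : x ∈ occ e w)
    (hy : y ∈ occ e w) :
    arcHol Q w x y =
      letterBefore (Q e) (sgn w y) * hol Q (arc w x y) * letterAfter (Q e) (sgn w x) := by
  rw [arcHol, arc]
  split_ifs with h
  · rw [seg_before Q hy (cutPoint_le_of_lt w h), seg_after Q hx h y.2.le, seg, mul_assoc]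
  · rw [seg_before Q hy (Nat.zero_le _), seg_after Q hx x.2 le_rfl, hol_append,
      seg_zero, seg_length]
    simp only [mul_assoc]

theorem sum_derivPair_of_same_sign {e : E} {w : EWord E} {x y : Fin w.length} (hx : x ∈ occ e w)
    (hy : y ∈ occ e w) (hxy : x ≠ y) (hs : sgn w x * sgn w y = 1) (Q : E → SO N) :
    ∑ i, ∑ j, derivPair i j w x y Q =
      2 * (W (negTwist w x y) Q - W (posSplit w x y) Q * W (posSplit w y x) Q) := by
  rw [sum_derivPair w hxy, arcHol_eq Q hx hy, arcHol_eq Q hy hx]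
  simp only [W_eq_tr, negTwist, posSplit, hol_append, hol_singleton, hol_inv]
  have hlx := letter_eq Q hx
  have hly := letter_eq Q hy
  simp only [sgn] at hlx hly
  rw [hlx, hly]
  simp only [sgn] at hs ⊢
  rcases Int.units_eq_one_or (w.get x).2 with h1 | h1 <;>
    rcases Int.units_eq_one_or (w.get y).2 with h2 | h2 <;>
    simp only [h1, h2] at hs ⊢ <;> try exact absurd hs (by decide)
  · simp only [letterBefore, letterAfter, if_true, Units.val_one, zpow_one, mul_one]
    congr 2
    -- Both sides are the same cyclic product read from different starting points; the conjugating
    -- element is the factor carried around from one end to the other. All later uses of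
    -- `tr_eq_of_conj` are of this kind.
    exact tr_eq_of_conj ((hol Q (arc w x y))⁻¹ * (Q e)⁻¹) (by group)
  · simp only [letterBefore, letterAfter, if_neg (show (-1 : ℤˣ) ≠ 1 by decide), one_mul,
      Units.val_neg, Units.val_one, zpow_neg_one, tr_mul_comm _ (Q e)⁻¹]
    congr 2
    exact tr_eq_of_conj (hol Q (arc w x y))⁻¹ (by group)

theorem sum_derivPair_of_opposite_sign {e : E} {w : EWord E} {x y : Fin w.length}
    (hx : x ∈ occ e w) (hy : y ∈ occ e w) (hs : sgn w x * sgn w y = -1)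
    (Q : E → SO N) :
    ∑ i, ∑ j, derivPair i j w x y Q =
      2 * (W (posTwist w x y) Q - W (negSplit w x y) Q * W (negSplit w y x) Q) := by
  have hxy : x ≠ y := by
    rintro rfl
    rw [Int.units_mul_self] at hs
    exact absurd hs (by decide)
  rw [sum_derivPair w hxy, arcHol_eq Q hx hy, arcHol_eq Q hy hx]
  simp only [W_eq_tr, posTwist, negSplit, hol_append, hol_singleton, hol_inv]
  have hlx := letter_eq Q hx
  have hly := letter_eq Q hy
  simp only [sgn] at hlx hly
  rw [hlx, hly]
  simp only [sgn] at hs ⊢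
  rcases Int.units_eq_one_or (w.get x).2 with h1 | h1 <;>
    rcases Int.units_eq_one_or (w.get y).2 with h2 | h2 <;>
    simp only [h1, h2] at hs ⊢ <;> try exact absurd hs (by decide)
  · simp only [letterBefore, letterAfter, if_true, if_neg (show (-1 : ℤˣ) ≠ 1 by decide),
      one_mul, mul_one, Units.val_neg, Units.val_one, zpow_one, zpow_neg_one]
    congr 2
    · exact tr_eq_of_conj ((Q e)⁻¹ * (hol Q (arc w x y))⁻¹) (by group)
    · congr 1
      exact tr_eq_of_conj (Q e)⁻¹ (by group)
  · simp only [letterBefore, letterAfter, if_true, if_neg (show (-1 : ℤˣ) ≠ 1 by decide),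
      one_mul, mul_one, Units.val_neg, Units.val_one, zpow_one, zpow_neg_one]
    congr 2
    · exact tr_eq_of_conj ((hol Q (arc w y x))⁻¹) (by group)
    · congr 1
      exact tr_eq_of_conj (Q e)⁻¹ (by group)

/-- If $\omega_x\omega_y=-1$, the prefactor exchanges the roles of the two traces; the exponents
$\mp\omega_x\omega_y$ in the definitions of the mergers compensate for this. -/
theorem merger_identity {e : E} {w v : EWord E} {x : Fin w.length} {y : Fin v.length}
    (hx : x ∈ occ e w) (hy : y ∈ occ e v) (Q : E → SO N) :
    ((sgn w x : ℤ) : ℝ) * ((sgn v y : ℤ) : ℝ) *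
      (tr (rotHol Q w x * (rotHol Q v y)⁻¹) - tr (rotHol Q w x * rotHol Q v y)) =
      W (negMerger w v x y) Q - W (posMerger w v x y) Q := by
  rw [rotHol_eq Q hx, rotHol_eq Q hy]
  simp only [W_eq_tr, negMerger, posMerger, hol_append, hol_singleton]
  have hlx := letter_eq Q hx
  simp only [sgn] at hlx
  rw [hlx]
  simp only [sgn]
  have hne : (-1 : ℤˣ) ≠ 1 := by decide
  rcases Int.units_eq_one_or (w.get x).2 with h1 | h1 <;>
    rcases Int.units_eq_one_or (v.get y).2 with h2 | h2 <;>
    simp only [h1, h2, letterBefore, letterAfter, if_true, if_neg hne, signPow, mul_neg, neg_mul,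
      neg_neg, one_mul, mul_one, Units.val_neg, Units.val_one, zpow_one, zpow_neg_one, hol_inv,
      Int.cast_neg, Int.cast_one, neg_sub]
  · congr 1
    · exact tr_eq_of_conj ((hol Q (cut v y))⁻¹ * (Q e)⁻¹) (by group)
    · exact tr_eq_of_conj (Q e * hol Q (cut v y)) (by group)
  · congr 1
    · exact tr_eq_of_conj (hol Q (cut v y) * (Q e)⁻¹) (by group)
    · exact tr_eq_of_conj (Q e * (hol Q (cut v y))⁻¹) (by group)
  · congr 1
    · exact tr_eq_of_conj (hol Q (cut v y)) (by group)
    · exact tr_eq_of_conj ((Q e)⁻¹ * (hol Q (cut v y))⁻¹ * (Q e)⁻¹) (by group)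
  · congr 1
    · exact tr_eq_of_conj (hol Q (cut v y))⁻¹ (by group)
    · exact tr_eq_of_conj ((Q e)⁻¹ * hol Q (cut v y) * (Q e)⁻¹) (by group)

theorem sum_derivW_mul_derivW (e : E) (w v : EWord E) (Q : E → SO N) :
    ∑ i, ∑ j, derivW e i j w Q * derivW e i j v Q =
      2 * ∑ x ∈ occ e w, ∑ y ∈ occ e v,
        (W (negMerger w v x y) Q - W (posMerger w v x y) Q) := by
  have h : ∀ i j, derivW e i j w Q * derivW e i j v Q = ∑ x ∈ occ e w, ∑ y ∈ occ e v,
      ((sgn w x : ℤ) : ℝ) * ((sgn v y : ℤ) : ℝ) *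
        (((rotHol Q w x : Matrix (Fin N) (Fin N) ℝ) * soGen i j).trace *
          ((rotHol Q v y : Matrix (Fin N) (Fin N) ℝ) * soGen i j).trace) := fun i j => by
    rw [derivW, derivW, Finset.sum_mul_sum]
    refine Finset.sum_congr rfl fun x _ => Finset.sum_congr rfl fun y _ => ?_
    rw [rotHol, rotHol]
    ring
  simp only [h]
  -- The sums over `i` and `j` are moved inside those over positions, so that the contraction
  -- applies to each pair.
  rw [Finset.sum_congr rfl fun i _ => Finset.sum_comm, Finset.sum_comm, Finset.mul_sum]
  refine Finset.sum_congr rfl fun x hx => ?_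
  rw [Finset.sum_congr rfl fun i _ => Finset.sum_comm, Finset.sum_comm, Finset.mul_sum]
  refine Finset.sum_congr rfl fun y hy => ?_
  simp only [← Finset.mul_sum]
  rw [sum_trace_mul_soGen_mul_trace_mul_soGen, ← merger_identity hx hy Q,
    trace_mul_transpose_eq_tr, ← Submonoid.coe_mul]
  simp only [tr]
  ring

end Contractions

/-! ### Continuity and expectations -/

section Expectation

variable {V E P : Type*} {N : ℕ}

theorem continuous_hol (w : EWord E) : Continuous fun Q : E → SO N => hol Q w := by
  induction w with
  | nil => exact continuous_const
  | cons d w ih => exact ih.mul ((continuous_apply d.1).zpow _)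

theorem continuous_seg (w : EWord E) (a b : ℕ) :
    Continuous fun Q : E → SO N => (seg Q w a b : Matrix (Fin N) (Fin N) ℝ) :=
  continuous_subtype_val.comp (continuous_hol _)

@[fun_prop]
theorem continuous_W (w : EWord E) : Continuous fun Q : E → SO N => W w Q :=
  (continuous_subtype_val.comp (continuous_hol w)).matrix_trace

@[fun_prop]
theorem continuous_derivW [DecidableEq E] (e : E) (i j : Fin N) (w : EWord E) :
    Continuous fun Q : E → SO N => derivW e i j w Q :=
  continuous_finsetSum _ fun _ _ => continuous_const.mul
    (((continuous_seg w _ _).mul (continuous_seg w _ _)).mul continuous_const).matrix_trace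

@[fun_prop]
theorem continuous_derivPair (i j : Fin N) (w : EWord E) (x y : Fin w.length) :
    Continuous fun Q : E → SO N => derivPair i j w x y Q := by
  unfold derivPair
  split_ifs <;>
  exact ((((continuous_seg w _ _).mul (continuous_seg w _ _)).mul continuous_const).mul
      ((continuous_seg w _ _).mul continuous_const)).matrix_trace

/-- Makes the product σ-algebra on gauge fields the Borel one, so that continuous functions of the
field are measurable. -/
instance : SecondCountableTopology (SO N) :=
  haveI : SecondCountableTopology (Matrix (Fin N) (Fin N) ℝ) :=
    inferInstanceAs (SecondCountableTopology (Fin N → Fin N → ℝ))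
  TopologicalSpace.Subtype.secondCountableTopology _

instance : (haarSO N).IsMulLeftInvariant :=
  inferInstanceAs (Measure.haarMeasure ⊤).IsMulLeftInvariant

instance : IsProbabilityMeasure (haarSO N) :=
  ⟨by simpa [haarSO] using
    Measure.haarMeasure_self (K₀ := (⊤ : TopologicalSpace.PositiveCompacts (SO N)))⟩

variable [Fintype E] [Fintype P]

theorem integrable_of_continuous {μ : Measure (E → SO N)} [IsFiniteMeasure μ]
    {f : (E → SO N) → ℝ} (hf : Continuous f) : Integrable f μ :=
  hf.integrable_of_hasCompactSupport (HasCompactSupport.of_compactSpace _)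

variable (Λ : TwoComplex V E P) (β : ℝ)

instance : IsProbabilityMeasure (ymMeasure Λ N β) :=
  isProbabilityMeasure_tilted (integrable_of_continuous (by fun_prop))

theorem ymExp_add {f g : (E → SO N) → ℝ} (hf : Continuous f) (hg : Continuous g) :
    ymExp Λ N β (fun Q => f Q + g Q) = ymExp Λ N β f + ymExp Λ N β g :=
  integral_add (integrable_of_continuous hf) (integrable_of_continuous hg)

theorem ymExp_sub {f g : (E → SO N) → ℝ} (hf : Continuous f) (hg : Continuous g) :
    ymExp Λ N β (fun Q => f Q - g Q) = ymExp Λ N β f - ymExp Λ N β g :=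
  integral_sub (integrable_of_continuous hf) (integrable_of_continuous hg)

theorem ymExp_const_mul (a : ℝ) (f : (E → SO N) → ℝ) :
    ymExp Λ N β (fun Q => a * f Q) = a * ymExp Λ N β f :=
  integral_const_mul _ _

theorem ymExp_sum {ι : Type*} (s : Finset ι) {f : ι → (E → SO N) → ℝ}
    (hf : ∀ i ∈ s, Continuous (f i)) :
    ymExp Λ N β (fun Q => ∑ i ∈ s, f i Q) = ∑ i ∈ s, ymExp Λ N β (f i) :=
  integral_finsetSum _ fun i hi => integrable_of_continuous (hf i hi)

/-- Integration by parts for the product Haar measure, applied to $e^Sf$; the derivative of the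
weight produces the plaquette term. -/
theorem ymExp_flowDeriv [DecidableEq E] (e : E) (i j : Fin N) {f f' : (E → SO N) → ℝ}
    (hf : Continuous f) (hf' : Continuous f') (h : HasFlowDeriv (edgeRot e i j) f f') :
    ymExp Λ N β (fun Q => f' Q + f Q * (β * N * ∑ p, derivW e i j (Λ.bdry p) Q)) = 0 := by
  have h0 := edgeRot_zero e i j
  have hS : HasFlowDeriv (edgeRot e i j) (fun Q => β * N * ∑ p, W (Λ.bdry p) Q)
      (fun Q => β * N * ∑ p, derivW e i j (Λ.bdry p) Q) :=
    (HasFlowDeriv.sum fun p _ => hasFlowDeriv_W e i j (Λ.bdry p)).const_mul _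
  have hE := (hS.exp h0).mul h0 h
  have := integral_flowDeriv_eq_zero (Measure.pi fun _ : E => haarSO N) (edgeRot_add e i j)
    (by fun_prop) (by fun_prop) hE
  rw [ymExp, ymMeasure, integral_tilted]
  simp only [smul_eq_mul, div_mul_eq_mul_div, integral_div]
  -- The normalisation $Z$ is a common denominator, so only the unnormalised integral has to vanish.
  rw [div_eq_zero_iff]
  left
  rw [← this]
  congr 1
  funext Q
  ring

end Expectation

/-! ### Assembling the master loop equation -/

section MasterLoop

variable {V E P : Type*} {N : ℕ}

/-- The contribution of the positions `x` and `y` of `w` to the Laplacian of the Wilson loop of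
`w` on one edge. -/
noncomputable def laplacePair (w : EWord E) (x y : Fin w.length) (Q : E → SO N) : ℝ :=
  (∑ i, ∑ j, derivPair i j w x y Q) / 2

@[fun_prop]
theorem continuous_laplacePair (w : EWord E) (x y : Fin w.length) :
    Continuous fun Q : E → SO N => laplacePair w x y Q := by
  unfold laplacePair
  fun_prop

/-- The sum of the negative mergers of `w` and `v` at `e`, minus the positive ones. -/
noncomputable def mergerSum [DecidableEq E] (e : E) (w v : EWord E) (Q : E → SO N) : ℝ :=
  ∑ x ∈ occ e w, ∑ y ∈ occ e v, (W (negMerger w v x y) Q - W (posMerger w v x y) Q)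

@[fun_prop]
theorem continuous_mergerSum [DecidableEq E] (e : E) (w v : EWord E) :
    Continuous fun Q : E → SO N => mergerSum e w v Q := by
  unfold mergerSum
  fun_prop

variable [DecidableEq E]

theorem sum_second_derivative (e : E) (w : EWord E) (Q : E → SO N) :
    ∑ i, ∑ j, ∑ x ∈ occ e w, ((sgn w x : ℤ) : ℝ) *
        ∑ y ∈ occ e w, ((sgn w y : ℤ) : ℝ) * derivPair i j w x y Q =
      2 * ∑ x ∈ occ e w, ∑ y ∈ occ e w,
        ((sgn w x * sgn w y : ℤˣ) : ℤ) * laplacePair w x y Q := by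
  rw [Finset.sum_congr rfl fun i _ => Finset.sum_comm, Finset.sum_comm, Finset.mul_sum]
  refine Finset.sum_congr rfl fun x hx => ?_
  simp only [Finset.mul_sum]
  rw [Finset.sum_congr rfl fun i _ => Finset.sum_comm, Finset.sum_comm]
  refine Finset.sum_congr rfl fun y hy => ?_
  simp only [← Finset.mul_sum, laplacePair]
  push_cast
  ring

variable [Fintype P]

theorem sum_plaqs (Λ : TwoComplex V E P) (e : E) (w : EWord E)
    (f : ∀ p, Fin w.length → Fin (Λ.bdry p).length → ℝ) :
    ∑ p ∈ plaqs Λ e, ∑ x ∈ occ e w, ∑ y ∈ occ e (Λ.bdry p), f p x y =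
      ∑ p, ∑ x ∈ occ e w, ∑ y ∈ occ e (Λ.bdry p), f p x y := by
  refine Finset.sum_subset (Finset.subset_univ _) fun p _ hp => ?_
  have h : occ e (Λ.bdry p) = ∅ := by
    simpa [plaqs, Finset.not_nonempty_iff_eq_empty] using hp
  simp [h]

variable [Fintype E]

/-- The summed integration by parts with the loop `w` differentiated twice: its Laplacian, its
mergers with the other loops, and its mergers with the plaquettes. -/
theorem ymExp_laplace_add_mergers (Λ : TwoComplex V E P) (β : ℝ) (e : E) {ι : Type*}
    [DecidableEq ι] (s : Finset ι) (w : EWord E) (v : ι → EWord E) :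
    ymExp Λ N β (fun Q =>
      (∑ x ∈ occ e w, ∑ y ∈ occ e w,
        (((sgn w x * sgn w y : ℤˣ) : ℤ) : ℝ) * (laplacePair w x y Q * ∏ k ∈ s, W (v k) Q)) +
      ((∑ k ∈ s, mergerSum e w (v k) Q * ∏ l ∈ s.erase k, W (v l) Q) +
      (N : ℝ) * β * ∑ p, mergerSum e w (Λ.bdry p) Q * ∏ k ∈ s, W (v k) Q)) = 0 := by
  -- The test function is the derivative of the Wilson loop of `w` times the product of the other
  -- Wilson loops.
  have hzero : ∀ i j : Fin N, _ := fun i j => ymExp_flowDeriv Λ β e i j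
    (by fun_prop) (by fun_prop) ((hasFlowDeriv_derivW e i j w).mul (edgeRot_zero e i j)
      (HasFlowDeriv.prod (s := s) (edgeRot_zero e i j) fun k _ => hasFlowDeriv_W e i j (v k)))
  have hsum : ∑ i : Fin N, ∑ j : Fin N, _ = ∑ i : Fin N, ∑ j : Fin N, (0 : ℝ) :=
    Finset.sum_congr rfl fun i _ => Finset.sum_congr rfl fun j _ => hzero i j
  rw [Finset.sum_congr rfl fun i _ => (ymExp_sum Λ β Finset.univ fun j _ => by fun_prop).symm,
    ← ymExp_sum Λ β Finset.univ fun i _ => by fun_prop] at hsum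
  simp only [Finset.sum_const_zero] at hsum
  -- Every contraction carries the factor 2 from counting each plane twice; it is cancelled here
  -- once for all terms.
  have h2 : ∀ a : ℝ, 2 * a = 0 → a = 0 := fun a h => by linarith
  apply h2
  rw [← ymExp_const_mul, ← hsum]
  congr 1
  funext Q
  have hm : ∀ u, 2 * mergerSum e w u Q = ∑ i, ∑ j, derivW e i j w Q * derivW e i j u Q :=
    fun u => (sum_derivW_mul_derivW e w u Q).symm
  have hD := sum_second_derivative e w Q
  have h1 : ∑ i, ∑ j, derivW e i j w Q *
        ∑ k ∈ s, derivW e i j (v k) Q * ∏ l ∈ s.erase k, W (v l) Q =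
      2 * ∑ k ∈ s, mergerSum e w (v k) Q * ∏ l ∈ s.erase k, W (v l) Q := by
    simp only [Finset.mul_sum, ← mul_assoc, hm, Finset.sum_mul]
    rw [Finset.sum_congr rfl fun i _ => Finset.sum_comm, Finset.sum_comm]
  have h3 : ∑ i, ∑ j, derivW e i j w Q * (∏ k ∈ s, W (v k) Q) *
        (β * N * ∑ p, derivW e i j (Λ.bdry p) Q) =
      2 * ((N : ℝ) * β * ∑ p, mergerSum e w (Λ.bdry p) Q * ∏ k ∈ s, W (v k) Q) := by
    have h4 : ∀ i j, derivW e i j w Q * (∏ k ∈ s, W (v k) Q) *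
        (β * N * ∑ p, derivW e i j (Λ.bdry p) Q) =
        (N : ℝ) * β * (∏ k ∈ s, W (v k) Q) *
          (derivW e i j w Q * ∑ p, derivW e i j (Λ.bdry p) Q) := fun i j => by ring
    have h5 : ∑ i, ∑ j, derivW e i j w Q * ∑ p, derivW e i j (Λ.bdry p) Q =
        2 * ∑ p, mergerSum e w (Λ.bdry p) Q := by
      simp only [Finset.mul_sum, hm]
      rw [Finset.sum_congr rfl fun i _ => Finset.sum_comm, Finset.sum_comm]
    simp only [h4, ← Finset.mul_sum, h5, ← Finset.sum_mul]
    ring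
  simp only [Finset.sum_add_distrib, h1, h3, ← Finset.sum_mul, hD]
  simp only [← mul_assoc, ← Finset.sum_mul]
  ring

/-- Pairs are sorted by $x=y$, equal signs and opposite signs. Each pair contributes twist minus
split, and the weight $\omega_x\omega_y$ reverses this for opposite signs. The negative splits need
no condition $x\ne y$, since $\omega_x^2=1$. -/
theorem ymExp_laplacePair_mul (Λ : TwoComplex V E P) (β : ℝ) {e : E} {w : EWord E}
    {F : (E → SO N) → ℝ} (hF : Continuous F) :
    ∑ x ∈ occ e w, ∑ y ∈ occ e w, (((sgn w x * sgn w y : ℤˣ) : ℤ) : ℝ) *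
        ymExp Λ N β (fun Q => laplacePair w x y Q * F Q) =
      -(((N : ℝ) - 1) * ((occ e w).card : ℝ) * ymExp Λ N β (fun Q => W w Q * F Q)) +
      ((∑ x ∈ occ e w, ∑ y ∈ occ e w with x ≠ y ∧ sgn w x * sgn w y = 1,
        ymExp Λ N β (fun Q => W (negTwist w x y) Q * F Q))
      - (∑ x ∈ occ e w, ∑ y ∈ occ e w with x ≠ y ∧ sgn w x * sgn w y = -1,
        ymExp Λ N β (fun Q => W (posTwist w x y) Q * F Q))
      + (∑ x ∈ occ e w, ∑ y ∈ occ e w with sgn w x * sgn w y = -1,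
        ymExp Λ N β (fun Q => W (negSplit w x y) Q * W (negSplit w y x) Q * F Q))
      - (∑ x ∈ occ e w, ∑ y ∈ occ e w with x ≠ y ∧ sgn w x * sgn w y = 1,
        ymExp Λ N β (fun Q => W (posSplit w x y) Q * W (posSplit w y x) Q * F Q))) := by
  have hcard : -(((N : ℝ) - 1) * ((occ e w).card : ℝ) * ymExp Λ N β (fun Q => W w Q * F Q)) =
      ∑ x ∈ occ e w, -((N : ℝ) - 1) * ymExp Λ N β (fun Q => W w Q * F Q) := by
    rw [Finset.sum_const, nsmul_eq_mul]; ring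
  rw [hcard, ← Finset.sum_sub_distrib, ← Finset.sum_add_distrib, ← Finset.sum_sub_distrib,
    ← Finset.sum_add_distrib]
  refine Finset.sum_congr rfl fun x hx => ?_
  -- The diagonal term is spread over `y` as an indicator, so that the identity can be checked for
  -- each pair separately.
  have hself : -((N : ℝ) - 1) * ymExp Λ N β (fun Q => W w Q * F Q) = ∑ y ∈ occ e w,
      if x = y then -((N : ℝ) - 1) * ymExp Λ N β (fun Q => W w Q * F Q) else 0 := by
    rw [Finset.sum_ite_eq, if_pos hx]
  rw [hself]
  simp only [Finset.sum_filter]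
  rw [← Finset.sum_sub_distrib, ← Finset.sum_add_distrib, ← Finset.sum_sub_distrib,
    ← Finset.sum_add_distrib]
  refine Finset.sum_congr rfl fun y hy => ?_
  have hne : (1 : ℤˣ) ≠ -1 := by decide
  rcases eq_or_ne x y with rfl | hxy
  · have hp : ∀ Q : E → SO N, laplacePair w x x Q = -((N : ℝ) - 1) * W w Q := fun Q => by
      rw [laplacePair, sum_derivPair_self]; ring
    simp only [hp, mul_assoc, ymExp_const_mul, Int.units_mul_self, hne]
    simp
  · rcases Int.units_eq_one_or (sgn w x * sgn w y) with hs | hs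
    · have hp : ∀ Q : E → SO N, laplacePair w x y Q * F Q = W (negTwist w x y) Q * F Q -
          W (posSplit w x y) Q * W (posSplit w y x) Q * F Q := fun Q => by
        rw [laplacePair, sum_derivPair_of_same_sign hx hy hxy hs]; ring
      simp only [hp, hs, hxy, hne]
      rw [ymExp_sub Λ β (by fun_prop) (by fun_prop)]
      simp [hxy]
    · have hp : ∀ Q : E → SO N, laplacePair w x y Q * F Q = W (posTwist w x y) Q * F Q -
          W (negSplit w x y) Q * W (negSplit w y x) Q * F Q := fun Q => by
        rw [laplacePair, sum_derivPair_of_opposite_sign hx hy hs]; ring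
      simp only [hp, hs, hxy, hne.symm]
      rw [ymExp_sub Λ β (by fun_prop) (by fun_prop)]
      simp [hxy]
      ring

theorem ymExp_mergerSum_mul (Λ : TwoComplex V E P) (β : ℝ) (e : E) (w v : EWord E)
    {F : (E → SO N) → ℝ} (hF : Continuous F) :
    ymExp Λ N β (fun Q => mergerSum e w v Q * F Q) =
      (∑ x ∈ occ e w, ∑ y ∈ occ e v, ymExp Λ N β (fun Q => W (negMerger w v x y) Q * F Q)) -
      ∑ x ∈ occ e w, ∑ y ∈ occ e v, ymExp Λ N β (fun Q => W (posMerger w v x y) Q * F Q) := by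
  simp only [mergerSum, Finset.sum_mul, sub_mul]
  rw [ymExp_sum Λ β _ fun x _ => by fun_prop, ← Finset.sum_sub_distrib]
  refine Finset.sum_congr rfl fun x _ => ?_
  rw [ymExp_sum Λ β _ fun y _ => by fun_prop, ← Finset.sum_sub_distrib]
  exact Finset.sum_congr rfl fun y _ => ymExp_sub Λ β (by fun_prop) (by fun_prop)

end MasterLoop

end LatticeYM

theorem theorem1 {V E P : Type*} [Fintype V] [Fintype E] [DecidableEq E] [Fintype P]
    (Λ : TwoComplex V E P) (N : ℕ) (β : ℝ) (n : ℕ)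
    (ℓ : Fin (n + 1) → EWord E) (hℓ : ∀ i, Λ.IsLoop (ℓ i)) (e : E) :
    ((N : ℝ) - 1) * ((occ e (ℓ 0)).card : ℝ) * ymExp Λ N β (fun Q => ∏ i, W (ℓ i) Q) =
      (∑ x ∈ occ e (ℓ 0), ∑ y ∈ occ e (ℓ 0) with x ≠ y ∧ sgn (ℓ 0) x * sgn (ℓ 0) y = 1,
        ymExp Λ N β (fun Q =>
          W (negTwist (ℓ 0) x y) Q * ∏ j ∈ Finset.univ.erase 0, W (ℓ j) Q))
      - (∑ x ∈ occ e (ℓ 0), ∑ y ∈ occ e (ℓ 0) with x ≠ y ∧ sgn (ℓ 0) x * sgn (ℓ 0) y = -1,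
        ymExp Λ N β (fun Q =>
          W (posTwist (ℓ 0) x y) Q * ∏ j ∈ Finset.univ.erase 0, W (ℓ j) Q))
      + (∑ x ∈ occ e (ℓ 0), ∑ y ∈ occ e (ℓ 0) with sgn (ℓ 0) x * sgn (ℓ 0) y = -1,
        ymExp Λ N β (fun Q =>
          W (negSplit (ℓ 0) x y) Q * W (negSplit (ℓ 0) y x) Q *
            ∏ j ∈ Finset.univ.erase 0, W (ℓ j) Q))
      - (∑ x ∈ occ e (ℓ 0), ∑ y ∈ occ e (ℓ 0) with x ≠ y ∧ sgn (ℓ 0) x * sgn (ℓ 0) y = 1,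
        ymExp Λ N β (fun Q =>
          W (posSplit (ℓ 0) x y) Q * W (posSplit (ℓ 0) y x) Q *
            ∏ j ∈ Finset.univ.erase 0, W (ℓ j) Q))
      + (∑ i ∈ Finset.univ.erase 0, ∑ x ∈ occ e (ℓ 0), ∑ y ∈ occ e (ℓ i),
        ymExp Λ N β (fun Q =>
          W (negMerger (ℓ 0) (ℓ i) x y) Q * ∏ j ∈ (Finset.univ.erase 0).erase i, W (ℓ j) Q))
      - (∑ i ∈ Finset.univ.erase 0, ∑ x ∈ occ e (ℓ 0), ∑ y ∈ occ e (ℓ i),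
        ymExp Λ N β (fun Q =>
          W (posMerger (ℓ 0) (ℓ i) x y) Q * ∏ j ∈ (Finset.univ.erase 0).erase i, W (ℓ j) Q))
      + (N : ℝ) * β * (∑ p ∈ plaqs Λ e, ∑ x ∈ occ e (ℓ 0), ∑ y ∈ occ e (Λ.bdry p),
        ymExp Λ N β (fun Q =>
          W (negMerger (ℓ 0) (Λ.bdry p) x y) Q * ∏ j ∈ Finset.univ.erase 0, W (ℓ j) Q))
      - (N : ℝ) * β * (∑ p ∈ plaqs Λ e, ∑ x ∈ occ e (ℓ 0), ∑ y ∈ occ e (Λ.bdry p),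
        ymExp Λ N β (fun Q =>
          W (posMerger (ℓ 0) (Λ.bdry p) x y) Q * ∏ j ∈ Finset.univ.erase 0, W (ℓ j) Q)) := by
  have hF : ∀ s : Finset (Fin (n + 1)), Continuous fun Q : E → SO N => ∏ j ∈ s, W (ℓ j) Q :=
    fun s => by fun_prop
  have key := ymExp_laplace_add_mergers (N := N) Λ β e (Finset.univ.erase 0) (ℓ 0) ℓ
  rw [ymExp_add Λ β (by fun_prop) (by fun_prop), ymExp_add Λ β (by fun_prop) (by fun_prop),
    ymExp_const_mul, ymExp_sum Λ β _ fun x _ => by fun_prop,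
    ymExp_sum Λ β _ fun k _ => by fun_prop, ymExp_sum Λ β _ fun p _ => by fun_prop,
    Finset.sum_congr rfl fun x _ => ymExp_sum Λ β _ fun y _ => by fun_prop] at key
  simp only [ymExp_const_mul] at key
  rw [ymExp_laplacePair_mul Λ β (hF _), Finset.sum_congr rfl fun k _ =>
    ymExp_mergerSum_mul Λ β e (ℓ 0) (ℓ k) (hF ((Finset.univ.erase 0).erase k)),
    -- The action involves all plaquettes; those whose boundary avoids `e` have no merger positions,
    -- which is why `sum_plaqs` may restrict the sum.
    Finset.sum_congr rfl fun p _ => ymExp_mergerSum_mul Λ β e (ℓ 0) (Λ.bdry p) (hF _),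
    Finset.sum_sub_distrib, Finset.sum_sub_distrib, ← sum_plaqs, ← sum_plaqs] at key
  have hprod : ∀ Q : E → SO N, ∏ i, W (ℓ i) Q =
      W (ℓ 0) Q * ∏ j ∈ Finset.univ.erase 0, W (ℓ j) Q := fun Q =>
    (Finset.mul_prod_erase _ _ (Finset.mem_univ 0)).symm
  simp only [hprod]
  linarith
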